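/- Let $\mathcal H=\mathbb C^{n_1}\otimes\cdots\otimes\mathbb C^{n_k}$ be the Hilbert space of a $k$-partite system, with local dimensions $n_1,\dots,n_k$ and total dimension $D=\prod_p n_p$. Let $N\ge 1$ and let $\mathbb S=\{\sigma_1,\dots,\sigma_N\}$ be density matrices on $\mathcal H$. A positive operator on $\mathcal H$ is called separable if it is a finite sum of tensor products of positive semidefinite local operators, up to nonnegative factors. The support of a density matrix is its range. For a density matrix $\sigma$ on $\mathcal H$ put - $d(\sigma)=\min_M \operatorname{Tr}M/\operatorname{Tr}(\sigma M)$ over the separable positive operators $M$ with $\operatorname{Tr}(\sigma M)>0$ and $0\le M/\operatorname{Tr}(\sigma M)\le I$; - $R_g(\sigma)$, the global robustness of entanglement: the minimal $t\ge 0$ such that $\frac{1}{1+t}(\sigma+t\varrho)$ is a separable state for some state $\varrho$; - $E_R(\sigma)=\min_\omega \operatorname{Tr}\sigma(\log_2\sigma-\log_2\omega)$ over the separable states $\omega$ whose support contains that of $\sigma$ (relative entropy of entanglement), and $S(\sigma)=-\operatorname{Tr}\sigma\log_2\sigma$; - $G(\sigma)=-\log_2\max_\varphi\langle\varphi|\sigma|\varphi\rangle$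 over the product unit vectors $\varphi$ (geometric measure). For each $i$ let $s_i$ be the support of $\sigma_i$ and let $Q_i$ be the set of all density matrices $\tau$ supported in $s_i$ with $\operatorname{rank}\tau=\dim s_i$. Put $$\mathcal R_i=\max_{\tau\in Q_i}\alpha(\tau)^{-1}\bigl(1+R_g(\tau)\bigr),\qquad \mathcal E_i=\sup_{\tau\in Q_i}\bigl(E_R(\tau)+S(\tau)\bigr),\qquad \mathcal G_i=\sup_{\tau\in Q_i}G(\tau),$$ where $\alpha(\tau)$ is the largest eigenvalue of $\tau$. Write $\overline{x_i}=\frac1N\sum_{i=1}^N x_i$. Theorem 3. Suppose that $\mathbb S$ is perfectly distinguishable by LOCC, i.e. some POVM $\{\Pi_1,\dots,\Pi_N\}$ that is implementable by local operations and classical communication (with finitely or infinitely many rounds) satisfies $\operatorname{Tr}(\Pi_i\sigma_j)=\delta_{ij}$. Then the maximum $\mathcal R_i$ is attained, the suprema $\mathcal E_i$ and $\mathcal G_i$ are finite, and $$N\;\le\;\frac{D}{\overline{d(\sigma_i)}}\;\le\;\frac{D}{\overline{\mathcal R_i}}\;\le\;\frac{D}{\overline{2^{\mathcal E_i}}}\;\le\;\frac{D}{\overline{2^{\mathcal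 G_i}}}.$$ -/

import Mathlib

open scoped NNReal ComplexOrder Matrix

noncomputable section

namespace LOCCBound

/-! ### States on a finite-dimensional Hilbert space `ℂ^ι` -/

section States

variable {ι : Type*} [Fintype ι] [DecidableEq ι]

/-- Density matrices. -/
def IsState (ρ : Matrix ι ι ℂ) : Prop := ρ.PosSemidef ∧ ρ.trace = 1

/-- The support of a density matrix: its range, i.e. the span of the eigenvectors with nonzero
eigenvalue. -/
def support (ρ : Matrix ι ι ℂ) : Submodule ℂ (ι → ℂ) := LinearMap.range ρ.mulVecLin

/-- The density matrices living in the subspace `s` whose rank equals `dim s`. -/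
def fullRankStates (s : Submodule ℂ (ι → ℂ)) : Set (Matrix ι ι ℂ) :=
  {τ | IsState τ ∧ support τ ≤ s ∧ τ.rank = Module.finrank ℂ s}

/-- The largest eigenvalue of a Hermitian matrix. -/
def maxEigenvalue (ρ : Matrix ι ι ℂ) : ℝ :=
  sSup {t : ℝ | Module.End.HasEigenvalue (Matrix.toLin' ρ) (t : ℂ)}

/-- The base-2 logarithm of a positive semidefinite matrix, taken to be `0` on the kernel. -/
def log2 (ρ : Matrix ι ι ℂ) : Matrix ι ι ℂ := cfc (Real.logb 2) ρ

/-- The von Neumann entropy `-Tr ρ log₂ ρ`. -/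
def entropy (ρ : Matrix ι ι ℂ) : ℝ := -(ρ * log2 ρ).trace.re

open Classical in
/-- The quantum relative entropy `Tr ρ (log₂ ρ - log₂ ω)`, which is `+∞` unless the support of `ρ`
is contained in that of `ω`. -/
def relEntropy (ρ ω : Matrix ι ι ℂ) : EReal :=
  if support ρ ≤ support ω then (((ρ * (log2 ρ - log2 ω)).trace.re : ℝ) : EReal) else ⊤

end States

/-! ### Composite systems

The parties are the elements of `Fin k`, party `p` holds `ℂ^(n p)`, and the tensor product of the
local spaces is `ℂ^(Idx n)`. -/

section Composite

variable {k : ℕ}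

/-- The index set of the product basis of `⨂ p, ℂ^(n p)`. -/
abbrev Idx (n : Fin k → ℕ) : Type := ∀ p, Fin (n p)

/-- The tensor product `⨂ p, A p` of local operators. -/
def tensor {n' n : Fin k → ℕ} (A : ∀ p, Matrix (Fin (n' p)) (Fin (n p)) ℂ) :
    Matrix (Idx n') (Idx n) ℂ :=
  Matrix.of fun x y => ∏ p, A p (x p) (y p)

/-- The product vector `⨂ p, v p`. -/
def tensorVec {n : Fin k → ℕ} (v : ∀ p, Fin (n p) → ℂ) : Idx n → ℂ :=
  fun x => ∏ p, v p (x p)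

/-- The cone of (unnormalized) separable operators: finite nonnegative combinations of tensor
products of positive semidefinite local operators. -/
def sepCone (n : Fin k → ℕ) : Submodule ℝ≥0 (Matrix (Idx n) (Idx n) ℂ) :=
  Submodule.span ℝ≥0 {X | ∃ A : ∀ p, Matrix (Fin (n p)) (Fin (n p)) ℂ,
    (∀ p, (A p).PosSemidef) ∧ X = tensor A}

/-- Separable density matrices. -/
def IsSepState {n : Fin k → ℕ} (ω : Matrix (Idx n) (Idx n) ℂ) : Prop :=
  IsState ω ∧ ω ∈ sepCone n

/-! ### LOCC measurements -/

/-- A finite-round LOCC protocol on local dimensions `n` whose final guess is one of `N` labels.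
At a leaf a guess is announced. In a round party `p` performs a measurement with Kraus operators
`V a p` and broadcasts the outcome `a`; then every other party `q` applies an isometry `V a q`
(attaching ancillas and rotating), and the protocol continues, depending on `a`, on local
dimensions `n' a`. A party that wants to discard information ignores part of the outcome. -/
inductive Protocol (k N : ℕ) : (Fin k → ℕ) → Type
  | leaf {n : Fin k → ℕ} (i : Fin N) : Protocol k N n
  | round {n : Fin k → ℕ} (p : Fin k) (r : ℕ) (n' : Fin r → Fin k → ℕ)
      (V : ∀ (a : Fin r) (q : Fin k), Matrix (Fin (n' a q)) (Fin (n q)) ℂ)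
      (complete : ∑ a, (V a p)ᴴ * V a p = 1)
      (isometry : ∀ a q, q ≠ p → (V a q)ᴴ * V a q = 1)
      (next : ∀ a, Protocol k N (n' a)) : Protocol k N n

/-- The POVM on the initial system implemented by a protocol. -/
def Protocol.povm {N : ℕ} : {n : Fin k → ℕ} → Protocol k N n → Fin N → Matrix (Idx n) (Idx n) ℂ
  | _, .leaf i => Pi.single i 1
  | _, .round _ _ _ V _ _ next => fun j =>
      ∑ a, (tensor (V a))ᴴ * (next a).povm j * tensor (V a)

/-- `Extends P Q`: the protocol `Q` arises from `P` by continuing at (some of) its leaves. -/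
inductive Protocol.Extends {N : ℕ} : {n : Fin k → ℕ} → Protocol k N n → Protocol k N n → Prop
  | leaf {n : Fin k → ℕ} (i : Fin N) (Q : Protocol k N n) : Extends (.leaf i) Q
  | round {n : Fin k → ℕ} (p : Fin k) (r : ℕ) (n' : Fin r → Fin k → ℕ)
      (V : ∀ (a : Fin r) (q : Fin k), Matrix (Fin (n' a q)) (Fin (n q)) ℂ)
      (complete : ∑ a, (V a p)ᴴ * V a p = 1)
      (isometry : ∀ a q, q ≠ p → (V a q)ᴴ * V a q = 1)
      (next next' : ∀ a, Protocol k N (n' a)) (h : ∀ a, Extends (next a) (next' a)) :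
      Extends (.round p r n' V complete isometry next)
        (.round p r n' V complete isometry next')

/-- The POVM `M` is implementable by LOCC, possibly with infinitely many rounds: it is the limit of
the POVMs of a sequence of finite-round protocols, each of which continues the previous one.
Finite-round protocols are the constant sequences. -/
def IsLOCC {N : ℕ} {n : Fin k → ℕ} (M : Fin N → Matrix (Idx n) (Idx n) ℂ) : Prop :=
  ∃ P : ℕ → Protocol k N n, (∀ t, (P t).Extends (P (t + 1))) ∧
    ∀ i, Filter.Tendsto (fun t => (P t).povm i) Filter.atTop (nhds (M i))

/-- The states `σ i` are perfectly distinguishable by LOCC. -/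
def PerfectlyLOCCDistinguishable {N : ℕ} {n : Fin k → ℕ}
    (σ : Fin N → Matrix (Idx n) (Idx n) ℂ) : Prop :=
  ∃ M : Fin N → Matrix (Idx n) (Idx n) ℂ, IsLOCC M ∧
    ∀ i j, (M i * σ j).trace = if i = j then 1 else 0

/-! ### The bounding quantities -/

variable {n : Fin k → ℕ}

/-- `d(σ) = min Tr M / Tr (σ M)` over the separable `M` with `0 ≤ M / Tr (σ M) ≤ 1`. -/
def sepDist (σ : Matrix (Idx n) (Idx n) ℂ) : ℝ :=
  sInf {x : ℝ | ∃ M ∈ sepCone n, 0 < (σ * M).trace.re ∧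
    (((σ * M).trace.re)⁻¹ • M).PosSemidef ∧ (1 - ((σ * M).trace.re)⁻¹ • M).PosSemidef ∧
    x = M.trace.re / (σ * M).trace.re}

/-- The global robustness of entanglement. -/
def globalRobustness (σ : Matrix (Idx n) (Idx n) ℂ) : ℝ :=
  sInf {t : ℝ | 0 ≤ t ∧ ∃ ρ : Matrix (Idx n) (Idx n) ℂ, IsState ρ ∧
    IsSepState ((1 + t)⁻¹ • (σ + t • ρ))}

/-- The relative entropy of entanglement: the least finite value of the relative entropy to a
separable state. -/
def relEntropyEnt (σ : Matrix (Idx n) (Idx n) ℂ) : ℝ :=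
  sInf {x : ℝ | ∃ ω : Matrix (Idx n) (Idx n) ℂ, IsSepState ω ∧ relEntropy σ ω = (x : EReal)}

/-- The geometric measure `-log₂ max ⟨φ|σ|φ⟩` over the product unit vectors `φ`. -/
def geomMeasure (σ : Matrix (Idx n) (Idx n) ℂ) : ℝ :=
  -Real.logb 2 (sSup {x : ℝ | ∃ v : ∀ p, Fin (n p) → ℂ, (∀ p, star (v p) ⬝ᵥ v p = 1) ∧
    x = (star (tensorVec v) ⬝ᵥ (σ *ᵥ tensorVec v)).re})

/-- The values `α⁻¹ (1 + R_g(τ))` over the full-rank states `τ` on the support of `σ`, where `α` is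
the largest eigenvalue of `τ`. -/
def robustnessValues (σ : Matrix (Idx n) (Idx n) ℂ) : Set ℝ :=
  (fun τ => (maxEigenvalue τ)⁻¹ * (1 + globalRobustness τ)) '' fullRankStates (support σ)

/-- The values `E_R(τ) + S(τ)` over the full-rank states `τ` on the support of `σ`. -/
def entropyValues (σ : Matrix (Idx n) (Idx n) ℂ) : Set ℝ :=
  (fun τ => relEntropyEnt τ + entropy τ) '' fullRankStates (support σ)

/-- The values `G(τ)` over the full-rank states `τ` on the support of `σ`. -/
def geomValues (σ : Matrix (Idx n) (Idx n) ℂ) : Set ℝ :=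
  geomMeasure '' fullRankStates (support σ)

/-- The quantity `𝓡` of the support of `σ`. -/
def optRobustness (σ : Matrix (Idx n) (Idx n) ℂ) : ℝ := sSup (robustnessValues σ)

/-- The quantity `𝓔` of the support of `σ`. -/
def optEntropy (σ : Matrix (Idx n) (Idx n) ℂ) : ℝ := sSup (entropyValues σ)

/-- The quantity `𝓖` of the support of `σ`. -/
def optGeom (σ : Matrix (Idx n) (Idx n) ℂ) : ℝ := sSup (geomValues σ)

end Composite

/-- The average `(1/N) ∑ i, x i`. -/
def avg {N : ℕ} (x : Fin N → ℝ) : ℝ := (1 / (N : ℝ)) * ∑ i, x i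

end LOCCBound

end

/-!
Let `P` be the support projection of `σ` and let `c(σ)` be the least trace of a separable operator
`X ≥ P` (`coverCost`). Every link of the chain compares one of the quantities with `c(σ)`.

* *Counting.* The POVM of a finite protocol consists of separable operators that sum to `1`
  (`povm_mem_sepCone`, `sum_povm`). The separable cone is closed (`mem_sepCone_of_tendsto`), being
  generated by the convex hull of the product projections, which is compact and lies in the
  hyperplane of trace-one operators; so this persists for limits of protocols. The element detecting
  `σ i` has trace at least `sepDist (σ i)`, and the traces add up to `D` (`sum_sepDist_le`).
* *Test operators.* A test `0 ≤ M ≤ 1` with `Tr σM = 1` acts as the identity on the support of `σ`,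
  hence `M ≥ P` (`sub_suppProj_posSemidef`) and `c(σ) ≤ d(σ)` (`coverCost_le_sepDist`).
* *Robustness.* `1 + R_g(τ)` is the least trace of a separable operator dominating `τ`. If `α` is
  the largest eigenvalue of `τ`, then `τ ≤ α P`, so `1 + R_g(τ) ≤ α c(σ)`, with equality at
  `τ = P / Tr P`. Thus `c(σ)` is the attained maximum `𝓡` (`isGreatest_robustnessValues`).
* *Entropy.* `E_R(τ) + S(τ)` is the infimum of `-Tr τ log₂ ω` over separable states `ω`. For
  `ω = X / Tr X` with `X ≥ P`, the bound `log x ≥ log a + 1 - a / x`, together with the fact that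
  the compression of the inverse of `X` to the range of `P` is at most `1`, gives
  `-Tr τ log₂ ω ≤ log₂ Tr X` (`logb_le_trace_mul_log2`), hence `2 ^ 𝓔 ≤ c(σ)`.
* *Geometric measure.* By Jensen's inequality `-Tr τ log₂ ω ≥ -log₂ Tr τω` (`trace_mul_log2_le`),
  and `Tr τω` is at most the largest overlap of `τ` with a product vector, as `ω` is a convex
  combination of product projections. Hence `G(τ) ≤ E_R(τ) + S(τ)` (`geomMeasure_le`).

The matrix logarithm, pseudoinverse and support projection are all given by the functional calculus,
with `log 0 = 0⁻¹ = 0` on the kernel, so the operator inequalities needed come from scalar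
inequalities on `[0, ∞)` that hold with these conventions at `0`.
-/

noncomputable section

namespace LOCCBound

/-! ### Positive semidefinite matrices and the functional calculus -/

section Operators

variable {ι : Type*} [Fintype ι]

open scoped MatrixOrder in
theorem exists_eq_conjTranspose_mul_self {A : Matrix ι ι ℂ} (hA : A.PosSemidef) :
    ∃ C : Matrix ι ι ℂ, A = Cᴴ * C := by
  classical
  exact CStarAlgebra.nonneg_iff_eq_star_mul_self.mp hA.nonneg

theorem posSemidef_of_projection {P : Matrix ι ι ℂ} (hP : P.IsHermitian) (hP2 : P * P = P) :
    P.PosSemidef := by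
  have := Matrix.posSemidef_conjTranspose_mul_self P
  rwa [hP.eq, hP2] at this

theorem IsState.nonempty {τ : Matrix ι ι ℂ} (hτ : IsState τ) : Nonempty ι := by
  by_contra h
  rw [not_nonempty_iff] at h
  have := hτ.2
  simp [Matrix.trace] at this

theorem trace_re_nonneg {A : Matrix ι ι ℂ} (hA : A.PosSemidef) : 0 ≤ A.trace.re :=
  (Complex.le_def.1 hA.trace_nonneg).1

theorem trace_eq_ofReal_re {A : Matrix ι ι ℂ} (hA : A.PosSemidef) :
    A.trace = ((A.trace.re : ℝ) : ℂ) := by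
  have := (Complex.le_def.1 hA.trace_nonneg).2
  apply Complex.ext <;> simp_all

theorem trace_mul_re_nonneg {A B : Matrix ι ι ℂ} (hA : A.PosSemidef) (hB : B.PosSemidef) :
    0 ≤ (A * B).trace.re := by
  obtain ⟨C, rfl⟩ := exists_eq_conjTranspose_mul_self hB
  rw [← Matrix.mul_assoc, Matrix.trace_mul_comm, ← Matrix.mul_assoc]
  exact trace_re_nonneg (hA.mul_mul_conjTranspose_same C)

theorem eq_zero_of_trace_re_eq_zero {A : Matrix ι ι ℂ} (hA : A.PosSemidef)
    (h : A.trace.re = 0) : A = 0 := by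
  obtain ⟨C, hC⟩ := exists_eq_conjTranspose_mul_self hA
  have h2 := trace_eq_ofReal_re hA
  rw [h, Complex.ofReal_zero, hC, Matrix.trace_conjTranspose_mul_self_eq_zero_iff] at h2
  rw [hC, h2, Matrix.mul_zero]

theorem mul_eq_zero_of_trace_mul_eq_zero {A B : Matrix ι ι ℂ} (hA : A.PosSemidef)
    (hB : B.PosSemidef) (h : (A * B).trace.re = 0) : B * A = 0 := by
  obtain ⟨C, hC⟩ := exists_eq_conjTranspose_mul_self hA
  obtain ⟨E, hE⟩ := exists_eq_conjTranspose_mul_self hB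
  have h1 : (A * B).trace = ((E * Cᴴ)ᴴ * (E * Cᴴ)).trace := by
    rw [hC, hE, Matrix.conjTranspose_mul, Matrix.conjTranspose_conjTranspose, Matrix.mul_assoc,
      Matrix.trace_mul_comm]
    simp only [Matrix.mul_assoc]
  rw [h1] at h
  have h2 := eq_zero_of_trace_re_eq_zero (Matrix.posSemidef_conjTranspose_mul_self _) h
  rw [Matrix.conjTranspose_mul_self_eq_zero] at h2
  rw [hC, hE, Matrix.mul_assoc, ← Matrix.mul_assoc E, h2, Matrix.zero_mul, Matrix.mul_zero]

variable [DecidableEq ι]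

/-- The spectrum is finite, so the functional calculus accepts every function. -/
theorem continuousOn_spectrum (f : ℝ → ℝ) (A : Matrix ι ι ℂ) :
    ContinuousOn f (spectrum ℝ A) :=
  Matrix.finite_real_spectrum.continuousOn f

open scoped MatrixOrder in
theorem posSemidef_cfc {A : Matrix ι ι ℂ} {f : ℝ → ℝ} (hf : ∀ x ∈ spectrum ℝ A, 0 ≤ f x) :
    (cfc f A).PosSemidef :=
  Matrix.nonneg_iff_posSemidef.1 (cfc_nonneg hf)

theorem isHermitian_cfc (f : ℝ → ℝ) (A : Matrix ι ι ℂ) : (cfc f A).IsHermitian :=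
  cfc_predicate f A

theorem spectrum_nonneg {A : Matrix ι ι ℂ} (hA : A.PosSemidef) {x : ℝ}
    (hx : x ∈ spectrum ℝ A) : 0 ≤ x := by
  open scoped MatrixOrder in
  exact spectrum_nonneg_of_nonneg (Matrix.nonneg_iff_posSemidef.2 hA) hx

theorem smul_one_sub_posSemidef_iff {A : Matrix ι ι ℂ} (hA : A.IsHermitian) (b : ℝ) :
    (b • (1 : Matrix ι ι ℂ) - A).PosSemidef ↔ ∀ x ∈ spectrum ℝ A, x ≤ b := by
  open scoped MatrixOrder in
  rw [← Matrix.le_iff, ← Algebra.algebraMap_eq_smul_one]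
  exact le_algebraMap_iff_spectrum_le hA.isSelfAdjoint

/-- A positive semidefinite matrix is dominated by its trace times the identity. -/
theorem trace_smul_one_sub_posSemidef {A : Matrix ι ι ℂ} (hA : A.PosSemidef) :
    (A.trace.re • (1 : Matrix ι ι ℂ) - A).PosSemidef := by
  rw [smul_one_sub_posSemidef_iff hA.1]
  intro x hx
  rw [hA.1.spectrum_real_eq_range_eigenvalues] at hx
  obtain ⟨i, rfl⟩ := hx
  have h := hA.1.trace_eq_sum_eigenvalues
  rw [h]
  simp only [Complex.coe_algebraMap, ← Complex.ofReal_sum, Complex.ofReal_re]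
  simpa using Finset.single_le_sum (fun j _ => hA.eigenvalues_nonneg j) (Finset.mem_univ i)

/-- The trace pairing with a positive semidefinite matrix is monotone in the function applied. -/
theorem trace_mul_cfc_mono {τ X : Matrix ι ι ℂ} (hτ : τ.PosSemidef) (hX : X.PosSemidef)
    {f g : ℝ → ℝ} (hfg : ∀ x, 0 ≤ x → f x ≤ g x) :
    (τ * cfc f X).trace.re ≤ (τ * cfc g X).trace.re := by
  have h := trace_mul_re_nonneg hτ (posSemidef_cfc (A := X) (f := fun x => g x - f x)
    fun x hx => sub_nonneg.2 (hfg x (spectrum_nonneg hX hx)))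
  rw [cfc_sub g f X (continuousOn_spectrum _ _) (continuousOn_spectrum _ _), Matrix.mul_sub,
    Matrix.trace_sub, Complex.sub_re] at h
  linarith

/-- The Moore–Penrose inverse of a Hermitian matrix. -/
def pinv (X : Matrix ι ι ℂ) : Matrix ι ι ℂ := cfc (fun x : ℝ => x⁻¹) X

/-- The orthogonal projection onto the range of a Hermitian matrix. -/
def suppProj (X : Matrix ι ι ℂ) : Matrix ι ι ℂ := cfc (fun x : ℝ => x * x⁻¹) X

theorem cfc_id_hermitian {X : Matrix ι ι ℂ} (hX : X.IsHermitian) :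
    cfc (fun x : ℝ => x) X = X := cfc_id' ℝ X hX.isSelfAdjoint

theorem cfc_mul_cfc (f g : ℝ → ℝ) (X : Matrix ι ι ℂ) :
    cfc f X * cfc g X = cfc (fun x => f x * g x) X :=
  (cfc_mul f g X (continuousOn_spectrum _ _) (continuousOn_spectrum _ _)).symm

theorem mul_pinv {X : Matrix ι ι ℂ} (hX : X.IsHermitian) : X * pinv X = suppProj X := by
  conv_lhs => enter [1]; rw [← cfc_id_hermitian hX]
  exact cfc_mul_cfc _ _ X

theorem suppProj_isHermitian (X : Matrix ι ι ℂ) : (suppProj X).IsHermitian := isHermitian_cfc _ X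

theorem pinv_isHermitian (X : Matrix ι ι ℂ) : (pinv X).IsHermitian := isHermitian_cfc _ X

theorem suppProj_mul_self {X : Matrix ι ι ℂ} (hX : X.IsHermitian) : suppProj X * X = X := by
  conv_lhs => enter [2]; rw [← cfc_id_hermitian hX]
  conv_rhs => rw [← cfc_id_hermitian hX]
  rw [suppProj, cfc_mul_cfc]
  congr 1; ext x
  by_cases h : x = 0 <;> simp [h]

theorem self_mul_suppProj {X : Matrix ι ι ℂ} (hX : X.IsHermitian) : X * suppProj X = X := by
  have h := congrArg Matrix.conjTranspose (suppProj_mul_self hX)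
  rwa [Matrix.conjTranspose_mul, (suppProj_isHermitian X).eq, hX.eq] at h

theorem suppProj_mul_suppProj (X : Matrix ι ι ℂ) : suppProj X * suppProj X = suppProj X := by
  rw [suppProj, cfc_mul_cfc]
  congr 1; ext x
  by_cases h : x = 0 <;> simp [h]

theorem pinv_mul_mul_pinv {X : Matrix ι ι ℂ} (hX : X.IsHermitian) :
    pinv X * X * pinv X = pinv X := by
  rw [Matrix.mul_assoc, mul_pinv hX, pinv, suppProj, cfc_mul_cfc]
  congr 1; ext x
  by_cases h : x = 0 <;> simp [h]

theorem suppProj_posSemidef (X : Matrix ι ι ℂ) : (suppProj X).PosSemidef :=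
  posSemidef_of_projection (suppProj_isHermitian X) (suppProj_mul_suppProj X)

theorem support_suppProj {X : Matrix ι ι ℂ} (hX : X.IsHermitian) :
    support (suppProj X) = support X := by
  apply le_antisymm
  · rintro _ ⟨v, rfl⟩
    exact ⟨pinv X *ᵥ v, by simp [Matrix.mulVec_mulVec, mul_pinv hX]⟩
  · rintro _ ⟨v, rfl⟩
    exact ⟨X *ᵥ v, by simp [Matrix.mulVec_mulVec, suppProj_mul_self hX]⟩

theorem suppProj_mul_of_support_le {X τ : Matrix ι ι ℂ} (hX : X.IsHermitian)
    (h : support τ ≤ support X) : suppProj X * τ = τ := by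
  apply Matrix.ext_of_mulVec_single
  intro i
  obtain ⟨u, hu⟩ := h ⟨Pi.single i 1, rfl⟩
  simp only [Matrix.mulVecLin_apply] at hu
  rw [← Matrix.mulVec_mulVec, ← hu, Matrix.mulVec_mulVec, suppProj_mul_self hX]

theorem mul_suppProj_of_support_le {X τ : Matrix ι ι ℂ} (hX : X.IsHermitian)
    (hτ : τ.IsHermitian) (h : support τ ≤ support X) : τ * suppProj X = τ := by
  have h := congrArg Matrix.conjTranspose (suppProj_mul_of_support_le hX h)
  rwa [Matrix.conjTranspose_mul, (suppProj_isHermitian X).eq, hτ.eq] at h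

/-- A positive semidefinite matrix dominating a positive multiple of a projection `P` has a range
that contains the range of `P`, since its kernel is annihilated by `P`. -/
theorem mul_suppProj_of_le {P X : Matrix ι ι ℂ} (hP : P.IsHermitian) (hP2 : P * P = P)
    (hX : X.PosSemidef) {a : ℝ} (ha : 0 < a) (h : (X - a • P).PosSemidef) :
    P * suppProj X = P := by
  obtain ⟨R, hR⟩ : ∃ R, R = 1 - suppProj X := ⟨_, rfl⟩
  have hXR : X * R = 0 := by
    rw [hR, Matrix.mul_sub, self_mul_suppProj hX.1, Matrix.mul_one, sub_self]
  have h1 := h.conjTranspose_mul_mul_same R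
  rw [Matrix.mul_sub, Matrix.sub_mul, Matrix.mul_assoc, hXR, Matrix.mul_zero, zero_sub] at h1
  have h2 : (P * R).conjTranspose * (P * R) = R.conjTranspose * P * R := by
    rw [Matrix.conjTranspose_mul, hP.eq, Matrix.mul_assoc, ← Matrix.mul_assoc P P R, hP2,
      Matrix.mul_assoc]
  have h3 := trace_re_nonneg h1
  have h4 := Matrix.posSemidef_conjTranspose_mul_self (P * R)
  have h5 : ((P * R).conjTranspose * (P * R)).trace = 0 := by
    rw [trace_eq_ofReal_re h4]
    have := trace_re_nonneg h4
    rw [h2] at this ⊢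
    simp only [Matrix.mul_smul, Matrix.smul_mul, Matrix.trace_neg, Matrix.trace_smul,
      Complex.neg_re, Complex.smul_re, smul_eq_mul] at h3
    have : (R.conjTranspose * P * R).trace.re = 0 := by nlinarith
    simp [this]
  have h6 : P * R = 0 := Matrix.trace_conjTranspose_mul_self_eq_zero_iff.1 h5
  rw [hR, Matrix.mul_sub, Matrix.mul_one, sub_eq_zero] at h6
  exact h6.symm

/-- If `Z` is Hermitian and `Z ^ 2 ≤ Z` then `Z ≤ 1`, as `1 - Z = (1 - Z) ^ 2 + (Z - Z ^ 2)`. -/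
theorem one_sub_posSemidef_of_sq_le {Z : Matrix ι ι ℂ} (hZ : Z.IsHermitian)
    (h : (Z - Z * Z).PosSemidef) : (1 - Z).PosSemidef := by
  have h1 := Matrix.posSemidef_conjTranspose_mul_self (1 - Z)
  rw [(Matrix.isHermitian_one.sub hZ).eq] at h1
  convert h1.add h using 1
  noncomm_ring

/-- If `a P ≤ X` then `a X⁻¹ ≤ 1` on the range of the projection `P`. -/
theorem one_sub_compress_pinv_posSemidef {P X : Matrix ι ι ℂ} (hP : P.IsHermitian)
    (hP2 : P * P = P) (hX : X.PosSemidef) {a : ℝ} (ha : 0 < a) (h : (X - a • P).PosSemidef) :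
    (1 - a • (P * pinv X * P)).PosSemidef := by
  have hY := pinv_isHermitian X
  apply one_sub_posSemidef_of_sq_le
  · have := Matrix.isHermitian_conjTranspose_mul_mul P hY
    rw [hP.eq] at this
    exact this.smul (IsSelfAdjoint.all a)
  · have h1 := (h.conjTranspose_mul_mul_same (pinv X)).conjTranspose_mul_mul_same P
    have h2 := h1.smul ha.le
    convert h2 using 1
    rw [hY.eq, hP.eq, Matrix.mul_sub, Matrix.sub_mul, pinv_mul_mul_pinv hX.1]
    simp only [Matrix.mul_smul, Matrix.smul_mul, Matrix.mul_sub, Matrix.sub_mul, smul_sub]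
    congr 3
    calc P * pinv X * P * (P * pinv X * P) = P * pinv X * (P * P) * pinv X * P := by
          noncomm_ring
      _ = _ := by rw [hP2]; noncomm_ring

theorem trace_mul_pinv_le {P X τ : Matrix ι ι ℂ} (hP : P.IsHermitian)
    (hP2 : P * P = P) (hX : X.PosSemidef) {a : ℝ} (ha : 0 < a) (h : (X - a • P).PosSemidef)
    (hτ : IsState τ) (hPτ : P * τ = τ) (hτP : τ * P = τ) :
    a * (τ * pinv X).trace.re ≤ 1 := by
  have h1 := trace_mul_re_nonneg hτ.1 (one_sub_compress_pinv_posSemidef hP hP2 hX ha h)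
  have h2 : (τ * (P * pinv X * P)).trace = (τ * pinv X).trace := by
    rw [← Matrix.mul_assoc, Matrix.trace_mul_comm, ← Matrix.mul_assoc, ← Matrix.mul_assoc, hPτ, hτP]
  rw [Matrix.mul_sub, Matrix.mul_one, Matrix.mul_smul, Matrix.trace_sub, Matrix.trace_smul, h2,
    hτ.2] at h1
  simpa using h1

theorem trace_mul_cfc_linear (τ X : Matrix ι ι ℂ) (b c : ℝ) (f g : ℝ → ℝ) :
    (τ * cfc (fun x => b * f x + c * g x) X).trace.re
      = b * (τ * cfc f X).trace.re + c * (τ * cfc g X).trace.re := by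
  rw [cfc_add X (fun x => b * f x) (fun x => c * g x) (continuousOn_spectrum _ _)
    (continuousOn_spectrum _ _), cfc_const_mul b f X (continuousOn_spectrum _ _),
    cfc_const_mul c g X (continuousOn_spectrum _ _)]
  simp [Matrix.mul_add, Matrix.trace_smul]

/-- If `a P ≤ X` then `Tr τ log₂ X ≥ log₂ a` for all states `τ` on the range of the projection `P`.
This follows from `log x ≥ log a + 1 - a / x` and `a X⁻¹ ≤ 1` on the range of `P`. -/
theorem logb_le_trace_mul_log2 {P X τ : Matrix ι ι ℂ} (hP : P.IsHermitian)
    (hP2 : P * P = P) (hX : X.PosSemidef) {a : ℝ} (ha : 0 < a) (h : (X - a • P).PosSemidef)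
    (hτ : IsState τ) (hPτ : P * τ = τ) (hτP : τ * P = τ) :
    Real.logb 2 a ≤ (τ * log2 X).trace.re := by
  have hl : 0 < Real.log 2 := Real.log_pos one_lt_two
  have h1 := trace_mul_pinv_le hP hP2 hX ha h hτ hPτ hτP
  have h2 : τ * suppProj X = τ := by
    rw [← hτP, Matrix.mul_assoc, mul_suppProj_of_le hP hP2 hX ha h]
  have h3 := trace_mul_cfc_mono hτ.1 hX
    (f := fun x => ((Real.log a + 1) / Real.log 2) * (x * x⁻¹) + (-a / Real.log 2) * x⁻¹)
    (g := Real.logb 2) (by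
      intro x hx
      rcases hx.eq_or_lt with rfl | hx
      · simp
      · have h4 := Real.log_le_sub_one_of_pos (div_pos ha hx)
        rw [Real.log_div ha.ne' hx.ne'] at h4
        rw [mul_inv_cancel₀ hx.ne', Real.logb, div_mul_eq_mul_div, div_mul_eq_mul_div, ← add_div]
        gcongr
        rw [div_eq_mul_inv] at h4
        linarith)
  rw [trace_mul_cfc_linear] at h3
  change _ * (τ * suppProj X).trace.re + _ * (τ * pinv X).trace.re ≤ _ at h3
  rw [h2, hτ.2] at h3
  refine le_trans ?_ h3
  simp only [Real.logb, Complex.one_re, mul_one]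
  rw [div_mul_eq_mul_div, ← add_div]
  gcongr
  linarith

theorem trace_mul_pos_of_support_le {τ X : Matrix ι ι ℂ} (hτ : IsState τ) (hX : X.PosSemidef)
    (h : support τ ≤ support X) : 0 < (τ * X).trace.re := by
  refine lt_of_le_of_ne (trace_mul_re_nonneg hτ.1 hX) fun h0 => ?_
  have h3 := mul_eq_zero_of_trace_mul_eq_zero hτ.1 hX h0.symm
  -- the ranges of `τ` and `X` would be orthogonal
  have h4 : suppProj X = pinv X * X := by
    have := congrArg Matrix.conjTranspose (mul_pinv hX.1)
    rwa [Matrix.conjTranspose_mul, (suppProj_isHermitian X).eq, (pinv_isHermitian X).eq, hX.1.eq,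
      eq_comm] at this
  have h5 := suppProj_mul_of_support_le hX.1 h
  rw [h4, Matrix.mul_assoc, h3, Matrix.mul_zero] at h5
  have := hτ.2
  rw [← h5] at this
  simp at this

/-- Jensen's inequality `Tr τ log₂ X ≤ log₂ Tr τ X`, from the tangent line of the logarithm at
`c = Tr τ X`. The constant term of the tangent is multiplied by `x * x⁻¹`, so that it vanishes at
`0` together with `Real.logb 2 0`. -/
theorem trace_mul_log2_le {τ X : Matrix ι ι ℂ} (hτ : IsState τ) (hX : X.PosSemidef)
    (h : support τ ≤ support X) : (τ * log2 X).trace.re ≤ Real.logb 2 (τ * X).trace.re := by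
  have hl : 0 < Real.log 2 := Real.log_pos one_lt_two
  have hc := trace_mul_pos_of_support_le hτ hX h
  set c := (τ * X).trace.re with hcdef
  have h3 := trace_mul_cfc_mono hτ.1 hX (f := Real.logb 2)
    (g := fun x => ((Real.log c - 1) / Real.log 2) * (x * x⁻¹) + (c⁻¹ / Real.log 2) * x) (by
      intro x hx
      rcases hx.eq_or_lt with rfl | hx
      · simp
      · have h4 := Real.log_le_sub_one_of_pos (div_pos hx hc)
        rw [Real.log_div hx.ne' hc.ne'] at h4
        rw [mul_inv_cancel₀ hx.ne', Real.logb, div_mul_eq_mul_div, div_mul_eq_mul_div, ← add_div]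
        gcongr
        rw [div_eq_inv_mul] at h4
        linarith)
  rw [trace_mul_cfc_linear, cfc_id_hermitian hX.1] at h3
  change _ ≤ _ * (τ * suppProj X).trace.re + _ at h3
  rw [mul_suppProj_of_support_le hX.1 hτ.1.1 h, hτ.2, ← hcdef] at h3
  refine h3.trans (le_of_eq ?_)
  simp only [Real.logb, Complex.one_re]
  field_simp
  ring

theorem trace_mul_le_one {τ X : Matrix ι ι ℂ} (hτ : IsState τ) (hX : IsState X) :
    (τ * X).trace.re ≤ 1 := by
  have h1 := trace_mul_re_nonneg hτ.1 (trace_smul_one_sub_posSemidef hX.1)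
  rw [hX.2, Matrix.mul_sub, Matrix.trace_sub, Complex.sub_re] at h1
  simpa [hτ.2] using h1

theorem setOf_hasEigenvalue (τ : Matrix ι ι ℂ) :
    {t : ℝ | Module.End.HasEigenvalue (Matrix.toLin' τ) (t : ℂ)} = spectrum ℝ τ := by
  ext t
  change Module.End.HasEigenvalue (Matrix.toLin' τ) (t : ℂ) ↔ _
  rw [Module.End.hasEigenvalue_iff_mem_spectrum, Matrix.spectrum_toLin',
    ← spectrum.algebraMap_mem_iff ℂ]
  rfl

theorem maxEigenvalue_smul_one_sub_posSemidef {τ : Matrix ι ι ℂ} (hτ : τ.IsHermitian) :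
    (maxEigenvalue τ • (1 : Matrix ι ι ℂ) - τ).PosSemidef := by
  rw [smul_one_sub_posSemidef_iff hτ, maxEigenvalue, setOf_hasEigenvalue]
  exact fun x hx => le_csSup Matrix.finite_real_spectrum.bddAbove hx

theorem maxEigenvalue_pos {τ : Matrix ι ι ℂ} (hτ : IsState τ) : 0 < maxEigenvalue τ := by
  by_contra! hα
  have h := trace_re_nonneg (maxEigenvalue_smul_one_sub_posSemidef hτ.1.1)
  rw [Matrix.trace_sub, hτ.2, Matrix.trace_smul, Matrix.trace_one] at h
  simp at h
  nlinarith [Nat.cast_nonneg (α := ℝ) (Fintype.card ι)]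

theorem maxEigenvalue_le {τ : Matrix ι ι ℂ} (hτ : IsState τ) {b : ℝ}
    (h : (b • (1 : Matrix ι ι ℂ) - τ).PosSemidef) : maxEigenvalue τ ≤ b := by
  have := hτ.nonempty
  rw [smul_one_sub_posSemidef_iff hτ.1.1] at h
  rw [maxEigenvalue, setOf_hasEigenvalue]
  exact csSup_le (ContinuousFunctionalCalculus.spectrum_nonempty τ hτ.1.1.isSelfAdjoint) h

end Operators

/-! ### Convex hulls of compact sets -/

section Convexity

/-- In a finite-dimensional space the convex hull of a compact set is compact: by Carathéodory's
theorem it is the set of convex combinations of `d + 1` points. -/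
theorem isCompact_convexHull_of_isCompact {E : Type*} [AddCommGroup E] [Module ℝ E]
    [FiniteDimensional ℝ E] [TopologicalSpace E] [ContinuousAdd E] [ContinuousSMul ℝ E]
    {s : Set E} (hs : IsCompact s) : IsCompact (convexHull ℝ s) := by
  obtain ⟨m, hm⟩ : ∃ m, m = Module.finrank ℝ E + 1 := ⟨_, rfl⟩
  have hcomb : convexHull ℝ s = (fun q : (Fin m → ℝ) × (Fin m → E) => ∑ i, q.1 i • q.2 i) ''
      (stdSimplex ℝ (Fin m) ×ˢ Set.pi Set.univ fun _ => s) := by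
    apply Set.Subset.antisymm
    · intro x hx
      rw [convexHull_eq_union] at hx
      simp only [Set.mem_iUnion] at hx
      obtain ⟨t, hts, hind, hx⟩ := hx
      have hcard : t.card ≤ m := by
        have := hind.card_le_finrank_succ
        rw [Fintype.card_coe] at this
        exact this.trans (hm ▸ Nat.succ_le_succ (Submodule.finrank_le _))
      have hne : Nonempty t := by
        by_contra h
        rw [not_nonempty_iff, Finset.isEmpty_coe_sort] at h
        simp [h] at hx
      obtain ⟨g, hg⟩ : ∃ g : Fin m → t, Function.Surjective g := by
        have e : t ↪ Fin m := (Fintype.equivFin t).toEmbedding.trans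
          (Fin.castLEEmb (by simpa using hcard))
        exact ⟨Function.invFun e, Function.invFun_surjective e.injective⟩
      have hrange : (t : Set E) = (Fintype.linearCombination ℝ fun i => (g i : E)) ''
          Set.range fun i j : Fin m => if i = j then (1 : ℝ) else 0 := by
        ext y
        simp only [Set.mem_image, Set.mem_range, exists_exists_eq_and,
          Fintype.linearCombination_apply, ite_smul, one_smul, zero_smul, Finset.sum_ite_eq,
          Finset.mem_univ, if_true]
        constructor
        · intro hy
          obtain ⟨i, hi⟩ := hg ⟨y, hy⟩
          exact ⟨i, by rw [hi]⟩
        · rintro ⟨i, rfl⟩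
          exact (g i).2
      rw [hrange, ← LinearMap.image_convexHull, convexHull_basis_eq_stdSimplex] at hx
      obtain ⟨w, hw, rfl⟩ := hx
      exact ⟨(w, fun i => (g i : E)), ⟨hw, fun i _ => hts (g i).2⟩, rfl⟩
    · rintro _ ⟨⟨w, z⟩, ⟨hw, hz⟩, rfl⟩
      exact (convex_convexHull ℝ s).sum_mem (fun i _ => hw.1 i) hw.2
        fun i _ => subset_convexHull ℝ s (hz i (Set.mem_univ i))
  rw [hcomb]
  refine ((isCompact_stdSimplex ℝ (Fin m)).prod (isCompact_univ_pi fun _ => hs)).image ?_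
  fun_prop

end Convexity

/-! ### Tensor products of matrices -/

section Tensor

variable {k : ℕ} {n n' n'' : Fin k → ℕ}

theorem tensor_mul (A : ∀ p, Matrix (Fin (n'' p)) (Fin (n' p)) ℂ)
    (B : ∀ p, Matrix (Fin (n' p)) (Fin (n p)) ℂ) :
    tensor A * tensor B = tensor fun p => A p * B p := by
  ext x y
  simp only [tensor, Matrix.mul_apply, Matrix.of_apply, ← Finset.prod_mul_distrib]
  rw [Finset.prod_univ_sum, Fintype.piFinset_univ]

theorem tensor_conjTranspose (A : ∀ p, Matrix (Fin (n' p)) (Fin (n p)) ℂ) :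
    (tensor A)ᴴ = tensor fun p => (A p)ᴴ := by
  ext x y
  simp [tensor]

theorem tensor_one : tensor (fun p => (1 : Matrix (Fin (n p)) (Fin (n p)) ℂ)) = 1 := by
  ext x y
  simp only [tensor, Matrix.of_apply, Matrix.one_apply, Finset.prod_ite_zero, Finset.prod_const_one,
    Finset.mem_univ, true_imp_iff, funext_iff]

theorem tensor_vecMulVec (v : ∀ p, Fin (n p) → ℂ) :
    tensor (fun p => Matrix.vecMulVec (v p) (star (v p)))
      = Matrix.vecMulVec (tensorVec v) (star (tensorVec v)) := by
  ext x y
  simp [tensor, tensorVec, Matrix.vecMulVec_apply, Finset.prod_mul_distrib]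

theorem tensor_sum {m : Fin k → ℕ} (A : ∀ p, Fin (m p) → Matrix (Fin (n' p)) (Fin (n p)) ℂ) :
    tensor (fun p => ∑ i, A p i) = ∑ f : ∀ p, Fin (m p), tensor fun p => A p (f p) := by
  ext x y
  simp only [tensor, Matrix.of_apply, Matrix.sum_apply]
  rw [Finset.prod_univ_sum, Fintype.piFinset_univ]

theorem tensor_posSemidef {A : ∀ p, Matrix (Fin (n p)) (Fin (n p)) ℂ}
    (hA : ∀ p, (A p).PosSemidef) : (tensor A).PosSemidef := by
  choose C hC using fun p => exists_eq_conjTranspose_mul_self (hA p)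
  have : tensor A = (tensor C)ᴴ * tensor C := by
    rw [tensor_conjTranspose, tensor_mul]
    exact congrArg tensor (funext hC)
  rw [this]
  exact Matrix.posSemidef_conjTranspose_mul_self _

/-- Local operators which are complete at one party and trivial elsewhere sum to the identity. -/
theorem sum_tensor_eq_one {r : ℕ} (p : Fin k) (W : Fin r → ∀ q, Matrix (Fin (n q)) (Fin (n q)) ℂ)
    (hp : ∑ a, W a p = 1) (hq : ∀ a q, q ≠ p → W a q = 1) : ∑ a, tensor (W a) = 1 := by
  rw [← tensor_one]
  ext x y
  simp only [tensor, Matrix.sum_apply, Matrix.of_apply]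
  have h : ∀ a, ∏ q, W a q (x q) (y q) = W a p (x p) (y p) *
      ∏ q ∈ Finset.univ.erase p, (1 : Matrix (Fin (n q)) (Fin (n q)) ℂ) (x q) (y q) := by
    intro a
    rw [← Finset.mul_prod_erase _ _ (Finset.mem_univ p)]
    congr 1
    exact Finset.prod_congr rfl fun q hqm => by rw [hq a q (Finset.ne_of_mem_erase hqm)]
  simp only [h]
  rw [← Finset.sum_mul, ← Matrix.sum_apply, hp]
  exact Finset.mul_prod_erase Finset.univ
    (fun q => (1 : Matrix (Fin (n q)) (Fin (n q)) ℂ) (x q) (y q)) (Finset.mem_univ p)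

end Tensor

/-! ### The separable cone -/

section Separable

variable {k : ℕ} {n n' : Fin k → ℕ}

theorem smul_mem_sepCone {X : Matrix (Idx n) (Idx n) ℂ} (hX : X ∈ sepCone n) {c : ℝ}
    (hc : 0 ≤ c) : c • X ∈ sepCone n :=
  (sepCone n).smul_mem (⟨c, hc⟩ : ℝ≥0) hX

theorem tensor_mem_sepCone {A : ∀ p, Matrix (Fin (n p)) (Fin (n p)) ℂ}
    (hA : ∀ p, (A p).PosSemidef) : tensor A ∈ sepCone n :=
  Submodule.subset_span ⟨A, hA, rfl⟩

theorem one_mem_sepCone : (1 : Matrix (Idx n) (Idx n) ℂ) ∈ sepCone n := by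
  rw [← tensor_one]
  exact tensor_mem_sepCone fun p => Matrix.PosSemidef.one

theorem posSemidef_of_mem_sepCone {X : Matrix (Idx n) (Idx n) ℂ} (hX : X ∈ sepCone n) :
    X.PosSemidef := by
  induction hX using Submodule.span_induction with
  | mem X h =>
    obtain ⟨A, hA, rfl⟩ := h
    exact tensor_posSemidef hA
  | zero => exact Matrix.PosSemidef.zero
  | add X Y _ _ hX hY => exact hX.add hY
  | smul c X _ hX => exact hX.smul c.2

theorem conj_tensor_mem_sepCone (V : ∀ p, Matrix (Fin (n' p)) (Fin (n p)) ℂ)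
    {X : Matrix (Idx n') (Idx n') ℂ} (hX : X ∈ sepCone n') :
    (tensor V)ᴴ * X * tensor V ∈ sepCone n := by
  induction hX using Submodule.span_induction with
  | mem X h =>
    obtain ⟨A, hA, rfl⟩ := h
    rw [tensor_conjTranspose, tensor_mul, tensor_mul]
    exact tensor_mem_sepCone fun p => (hA p).conjTranspose_mul_mul_same (V p)
  | zero => simp
  | add X Y _ _ hX hY =>
    rw [Matrix.mul_add, Matrix.add_mul]
    exact add_mem hX hY
  | smul c X _ hX =>
    rw [Matrix.mul_smul, Matrix.smul_mul]
    exact Submodule.smul_mem _ c hX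

/-- The rank-one projections onto product unit vectors. -/
def productProjections (n : Fin k → ℕ) : Set (Matrix (Idx n) (Idx n) ℂ) :=
  {X | ∃ v : ∀ p, Fin (n p) → ℂ, (∀ p, star (v p) ⬝ᵥ v p = 1) ∧
    X = Matrix.vecMulVec (tensorVec v) (star (tensorVec v))}

theorem tensorVec_norm {v : ∀ p, Fin (n p) → ℂ} (hv : ∀ p, star (v p) ⬝ᵥ v p = 1) :
    star (tensorVec v) ⬝ᵥ tensorVec v = 1 := by
  have : star (tensorVec v) ⬝ᵥ tensorVec v = ∏ p, star (v p) ⬝ᵥ v p := by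
    simp only [dotProduct, tensorVec, Pi.star_apply, star_prod, ← Finset.prod_mul_distrib]
    rw [Finset.prod_univ_sum, Fintype.piFinset_univ]
  rw [this]
  exact Finset.prod_eq_one fun p _ => hv p

theorem trace_of_mem_productProjections {X : Matrix (Idx n) (Idx n) ℂ}
    (hX : X ∈ productProjections n) : X.trace = 1 := by
  obtain ⟨v, hv, rfl⟩ := hX
  rw [Matrix.trace_vecMulVec, dotProduct_comm]
  exact tensorVec_norm hv

/-- A rank-one operator is a nonnegative multiple of the projection onto a unit vector. -/
theorem exists_unit_vector {m : ℕ} (hm : 0 < m) (w : Fin m → ℂ) :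
    ∃ (c : ℝ≥0) (u : Fin m → ℂ), star u ⬝ᵥ u = 1 ∧
      Matrix.vecMulVec w (star w) = (c : ℂ) • Matrix.vecMulVec u (star u) := by
  by_cases hw : w = 0
  · exact ⟨0, Pi.single ⟨0, hm⟩ 1, by simp, by simp [hw]⟩
  · have h0 : star w ⬝ᵥ w ≠ 0 := fun h => hw (dotProduct_star_self_eq_zero.1 h)
    obtain ⟨h1, h2⟩ := Complex.le_def.1 (dotProduct_star_self_nonneg w)
    obtain ⟨c, hc⟩ : ∃ c : ℝ, star w ⬝ᵥ w = c := ⟨(star w ⬝ᵥ w).re, by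
      apply Complex.ext <;> simp_all⟩
    rw [hc] at h0 h1
    simp only [Complex.zero_re, Complex.ofReal_re] at h1
    have hs : ((√c : ℝ) : ℂ) * ((√c : ℝ) : ℂ) = c := by
      rw [← Complex.ofReal_mul, Real.mul_self_sqrt h1]
    have hs0 : ((√c : ℝ) : ℂ) ≠ 0 := fun h => h0 (by rw [← hs, h, mul_zero])
    refine ⟨c.toNNReal, ((√c : ℝ) : ℂ)⁻¹ • w, ?_, ?_⟩
    · simp only [star_smul, smul_dotProduct, dotProduct_smul, hc, smul_eq_mul, ← hs]
      simp [hs0]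
    · ext i j
      simp only [Matrix.vecMulVec_apply, Matrix.smul_apply, Pi.smul_apply, Pi.star_apply,
        smul_eq_mul, star_mul', star_inv₀, Complex.star_def, Complex.conj_ofReal,
        Real.coe_toNNReal c h1]
      rw [← hs]
      field_simp

/-- The separable cone is generated by the projections onto product vectors. -/
theorem sepCone_eq_span (hn : ∀ p, 0 < n p) :
    sepCone n = Submodule.span ℝ≥0 (productProjections n) := by
  apply le_antisymm
  · refine Submodule.span_le.2 ?_
    rintro _ ⟨A, hA, rfl⟩
    choose m v hv using fun p => Matrix.posSemidef_iff_eq_sum_vecMulVec.1 (hA p)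
    rw [show tensor A = tensor fun p => _ from congrArg tensor (funext hv), tensor_sum]
    refine sum_mem fun f _ => ?_
    choose c u hu hc using fun p => exists_unit_vector (hn p) (v p (f p))
    have h : (tensor fun p => Matrix.vecMulVec (v p (f p)) (star (v p (f p))))
        = (∏ p, c p) • Matrix.vecMulVec (tensorVec u) (star (tensorVec u)) := by
      rw [← tensor_vecMulVec]
      ext x y
      simp only [tensor, hc, Matrix.of_apply, Matrix.smul_apply, smul_eq_mul,
        Finset.prod_mul_distrib, NNReal.smul_def, NNReal.coe_prod, Complex.real_smul,
        Complex.ofReal_prod]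
    rw [h]
    exact Submodule.smul_mem _ _ (Submodule.subset_span ⟨u, hu, rfl⟩)
  · refine Submodule.span_mono ?_
    rintro _ ⟨v, hv, rfl⟩
    exact ⟨_, fun p => Matrix.posSemidef_vecMulVec_self_star (v p), (tensor_vecMulVec v).symm⟩

theorem isCompact_productProjections (n : Fin k → ℕ) : IsCompact (productProjections n) := by
  have hS : IsCompact {v : ∀ p, Fin (n p) → ℂ | ∀ p, star (v p) ⬝ᵥ v p = 1} := by
    refine Metric.isCompact_of_isClosed_isBounded ?_ ?_
    · simp only [Set.ofPred_forall]
      refine isClosed_iInter fun p => isClosed_eq ?_ continuous_const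
      simp only [dotProduct, Pi.star_apply]
      fun_prop
    · refine (Metric.isBounded_closedBall (x := 0) (r := 1)).subset fun v hv => ?_
      rw [mem_closedBall_zero_iff, pi_norm_le_iff_of_nonneg zero_le_one]
      intro p
      rw [pi_norm_le_iff_of_nonneg zero_le_one]
      intro i
      have h := congrArg Complex.re (hv p)
      simp only [dotProduct, Pi.star_apply, Complex.star_def, Complex.conj_mul', Complex.re_sum,
        Complex.one_re, ← Complex.ofReal_pow, Complex.ofReal_re] at h
      have h2 := Finset.single_le_sum (f := fun j => ‖v p j‖ ^ 2) (fun j _ => sq_nonneg _)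
        (Finset.mem_univ i)
      rw [h] at h2
      nlinarith [norm_nonneg (v p i)]
  have himage : productProjections n = (fun v : ∀ p, Fin (n p) → ℂ =>
      Matrix.vecMulVec (tensorVec v) (star (tensorVec v))) ''
        {v | ∀ p, star (v p) ⬝ᵥ v p = 1} := by
    ext X
    exact ⟨fun ⟨v, hv, h⟩ => ⟨v, hv, h.symm⟩, fun ⟨v, hv, h⟩ => ⟨v, hv, h.symm⟩⟩
  rw [himage]
  refine hS.image ?_
  refine continuous_matrix fun x y => ?_
  simp only [Matrix.vecMulVec_apply, tensorVec, Pi.star_apply]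
  fun_prop

theorem trace_of_mem_convexHull {X : Matrix (Idx n) (Idx n) ℂ}
    (hX : X ∈ convexHull ℝ (productProjections n)) : X.trace = 1 := by
  refine convexHull_min (t := {X | X.trace = 1}) (fun X => trace_of_mem_productProjections) ?_ hX
  intro X hX Y hY a b _ _ hab
  change Matrix.trace _ = 1
  rw [Matrix.trace_add, Matrix.trace_smul, Matrix.trace_smul, hX, hY, ← add_smul, hab, one_smul]

theorem convexHull_subset_sepCone (hn : ∀ p, 0 < n p) {X : Matrix (Idx n) (Idx n) ℂ}
    (hX : X ∈ convexHull ℝ (productProjections n)) : X ∈ sepCone n := by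
  refine convexHull_min (t := sepCone n) ?_ ?_ hX
  · rw [sepCone_eq_span hn]
    exact Submodule.subset_span
  · intro X hX Y hY a b ha hb _
    exact add_mem (smul_mem_sepCone hX ha) (smul_mem_sepCone hY hb)

/-- The convex hull of the product projections is a base of the separable cone. -/
theorem exists_eq_trace_smul (hn : ∀ p, 0 < n p) {X : Matrix (Idx n) (Idx n) ℂ}
    (hX : X ∈ sepCone n) :
    ∃ Y ∈ convexHull ℝ (productProjections n), X = X.trace.re • Y := by
  suffices h : ∃ c : ℝ, 0 ≤ c ∧ ∃ Y ∈ convexHull ℝ (productProjections n), X = c • Y by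
    obtain ⟨c, -, Y, hY, rfl⟩ := h
    refine ⟨Y, hY, ?_⟩
    rw [Matrix.trace_smul, trace_of_mem_convexHull hY]
    simp
  rw [sepCone_eq_span hn] at hX
  induction hX using Submodule.span_induction with
  | mem X h => exact ⟨1, zero_le_one, X, subset_convexHull ℝ _ h, (one_smul _ _).symm⟩
  | zero =>
    refine ⟨0, le_rfl, _, subset_convexHull ℝ _
      ⟨fun p => Pi.single ⟨0, hn p⟩ 1, fun p => by simp, rfl⟩, by simp⟩
  | add X Y _ _ hX hY =>
    obtain ⟨a, ha, X, hX, rfl⟩ := hX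
    obtain ⟨b, hb, Y, hY, rfl⟩ := hY
    rcases (add_nonneg ha hb).eq_or_lt with h | h
    · obtain rfl : a = 0 := by linarith
      obtain rfl : b = 0 := by linarith
      exact ⟨0, le_rfl, X, hX, by simp⟩
    · refine ⟨a + b, h.le, _, convex_convexHull ℝ _ hX hY (a := a / (a + b)) (b := b / (a + b))
        (by positivity) (by positivity) (by field_simp), ?_⟩
      rw [smul_add, smul_smul, smul_smul]
      field_simp
  | smul c X _ hX =>
    obtain ⟨a, ha, X, hX, rfl⟩ := hX
    exact ⟨c * a, mul_nonneg c.2 ha, X, hX, by rw [← smul_smul]; rfl⟩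

/-- The separable cone is closed, as it is spanned by a compact convex set of trace-one
operators. -/
theorem mem_sepCone_of_tendsto (hn : ∀ p, 0 < n p) {f : ℕ → Matrix (Idx n) (Idx n) ℂ}
    {X : Matrix (Idx n) (Idx n) ℂ} (hf : ∀ t, f t ∈ sepCone n)
    (hX : Filter.Tendsto f Filter.atTop (nhds X)) : X ∈ sepCone n := by
  choose Y hY hfY using fun t => exists_eq_trace_smul hn (hf t)
  have hcomp := isCompact_convexHull_of_isCompact (isCompact_productProjections n)
  -- along an ultrafilter the normalized operators converge in the compact base
  obtain ⟨Z, hZ, hlim⟩ := hcomp.ultrafilter_le_nhds ((Filter.hyperfilter ℕ).map Y)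
    (Filter.le_principal_iff.2 (Filter.mem_map.2 (Filter.univ_mem' hY)))
  have hfX : Filter.Tendsto f (Filter.hyperfilter ℕ) (nhds X) :=
    hX.mono_left (Nat.hyperfilter_le_atTop)
  have htr : Filter.Tendsto (fun t => (f t).trace.re) (Filter.hyperfilter ℕ)
      (nhds X.trace.re) := by
    have hcont : Continuous fun A : Matrix (Idx n) (Idx n) ℂ => A.trace.re :=
      Complex.continuous_re.comp (Continuous.matrix_trace continuous_id)
    exact (hcont.tendsto X).comp hfX
  have hlim' : Filter.Tendsto f (Filter.hyperfilter ℕ) (nhds (X.trace.re • Z)) := by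
    rw [show f = fun t => (f t).trace.re • Y t from funext hfY]
    exact htr.smul hlim
  rw [tendsto_nhds_unique hfX hlim']
  exact smul_mem_sepCone (convexHull_subset_sepCone hn hZ)
    (ge_of_tendsto' htr fun t => trace_re_nonneg (posSemidef_of_mem_sepCone (hf t)))

end Separable

/-! ### LOCC measurements are separable -/

section Measurement

variable {k N : ℕ} {n : Fin k → ℕ}

theorem povm_mem_sepCone (P : Protocol k N n) (j : Fin N) : P.povm j ∈ sepCone n := by
  induction P with
  | leaf i =>
    by_cases h : j = i
    · subst h
      simpa [Protocol.povm] using one_mem_sepCone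
    · simp [Protocol.povm, h]
  | round p r n' V complete isometry next ih =>
    exact sum_mem fun a _ => conj_tensor_mem_sepCone (V a) (ih a)

theorem sum_povm (P : Protocol k N n) : ∑ j, P.povm j = 1 := by
  induction P with
  | leaf i => simp [Protocol.povm]
  | round p r n' V complete isometry next ih =>
    simp only [Protocol.povm]
    rw [Finset.sum_comm]
    simp only [← Matrix.mul_sum, ← Matrix.sum_mul, ih, Matrix.mul_one, tensor_conjTranspose,
      tensor_mul]
    exact sum_tensor_eq_one p _ complete isometry

theorem IsLOCC.mem_sepCone (hn : ∀ p, 0 < n p) {M : Fin N → Matrix (Idx n) (Idx n) ℂ}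
    (hM : IsLOCC M) (i : Fin N) : M i ∈ sepCone n := by
  obtain ⟨P, -, hP⟩ := hM
  exact mem_sepCone_of_tendsto hn (fun t => povm_mem_sepCone (P t) i) (hP i)

theorem IsLOCC.sum_eq_one {M : Fin N → Matrix (Idx n) (Idx n) ℂ} (hM : IsLOCC M) :
    ∑ i, M i = 1 := by
  obtain ⟨P, -, hP⟩ := hM
  have h := tendsto_finsetSum Finset.univ fun i _ => hP i
  simp only [sum_povm] at h
  exact tendsto_nhds_unique h tendsto_const_nhds

end Measurement

/-! ### Support projections of states -/

section SupportProjection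

variable {ι : Type*} [Fintype ι]

theorem support_smul {c : ℝ} (hc : c ≠ 0) (A : Matrix ι ι ℂ) : support (c • A) = support A := by
  apply le_antisymm
  · rintro _ ⟨v, rfl⟩
    exact ⟨c • v, by simp⟩
  · rintro _ ⟨v, rfl⟩
    exact ⟨c⁻¹ • v, by simp [smul_smul, hc]⟩

theorem support_mul_le (A B : Matrix ι ι ℂ) : support (A * B) ≤ support A := by
  rintro _ ⟨v, rfl⟩
  exact ⟨B *ᵥ v, by simp [Matrix.mulVec_mulVec]⟩

variable [DecidableEq ι] {σ τ : Matrix ι ι ℂ}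

theorem one_sub_suppProj_posSemidef (σ : Matrix ι ι ℂ) : (1 - suppProj σ).PosSemidef := by
  apply one_sub_posSemidef_of_sq_le (suppProj_isHermitian σ)
  rw [suppProj_mul_suppProj, sub_self]
  exact Matrix.PosSemidef.zero

theorem trace_suppProj_pos (hσ : IsState σ) : 0 < (suppProj σ).trace.re := by
  refine lt_of_le_of_ne (trace_re_nonneg (suppProj_posSemidef σ)) fun h => ?_
  have h1 := suppProj_mul_self hσ.1.1
  rw [eq_zero_of_trace_re_eq_zero (suppProj_posSemidef σ) h.symm, Matrix.zero_mul] at h1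
  have h2 := hσ.2
  simp [← h1] at h2

/-- The maximally mixed state on the support of `σ`. -/
def mixedState (σ : Matrix ι ι ℂ) : Matrix ι ι ℂ := (suppProj σ).trace.re⁻¹ • suppProj σ

theorem mixedState_isState (hσ : IsState σ) : IsState (mixedState σ) := by
  refine ⟨(suppProj_posSemidef σ).smul (inv_nonneg.2 (trace_suppProj_pos hσ).le), ?_⟩
  have h := trace_suppProj_pos hσ
  rw [mixedState, Matrix.trace_smul]
  conv_lhs => rw [trace_eq_ofReal_re (suppProj_posSemidef σ)]
  rw [Complex.ofReal_re, Complex.real_smul, ← Complex.ofReal_mul, inv_mul_cancel₀ h.ne',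
    Complex.ofReal_one]

theorem mixedState_mem (hσ : IsState σ) : mixedState σ ∈ fullRankStates (support σ) := by
  have h : support (mixedState σ) = support σ := by
    rw [mixedState, support_smul (inv_ne_zero (trace_suppProj_pos hσ).ne'),
      support_suppProj hσ.1.1]
  refine ⟨mixedState_isState hσ, h.le, ?_⟩
  rw [← h]
  rfl

theorem maxEigenvalue_mixedState_le (hσ : IsState σ) :
    maxEigenvalue (mixedState σ) ≤ (suppProj σ).trace.re⁻¹ := by
  refine maxEigenvalue_le (mixedState_isState hσ) ?_
  rw [mixedState, ← smul_sub]
  exact (one_sub_suppProj_posSemidef σ).smul (inv_nonneg.2 (trace_suppProj_pos hσ).le)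

theorem maxEigenvalue_smul_suppProj_sub_posSemidef (hσ : σ.IsHermitian) (hτ : τ.IsHermitian)
    (h : support τ ≤ support σ) : (maxEigenvalue τ • suppProj σ - τ).PosSemidef := by
  have h1 := (maxEigenvalue_smul_one_sub_posSemidef hτ).conjTranspose_mul_mul_same (suppProj σ)
  rwa [(suppProj_isHermitian σ).eq, Matrix.mul_sub, Matrix.sub_mul, Matrix.mul_smul,
    Matrix.mul_one, Matrix.smul_mul, suppProj_mul_suppProj, suppProj_mul_of_support_le hσ h,
    mul_suppProj_of_support_le hσ hτ h] at h1

/-- A test operator `0 ≤ M ≤ 1` that detects `σ` with certainty dominates the support projection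
of `σ`. -/
theorem sub_suppProj_posSemidef {M : Matrix ι ι ℂ} (hσ : IsState σ) (hM : M.PosSemidef)
    (hM1 : (1 - M).PosSemidef) (htr : (σ * M).trace.re = 1) : (M - suppProj σ).PosSemidef := by
  have h1 : (1 - M) * σ = 0 := by
    apply mul_eq_zero_of_trace_mul_eq_zero hσ.1 hM1
    rw [Matrix.mul_sub, Matrix.mul_one, Matrix.trace_sub, hσ.2, Complex.sub_re, htr,
      Complex.one_re, sub_self]
  have h2 : M * suppProj σ = suppProj σ := by
    rw [← mul_pinv hσ.1.1, ← Matrix.mul_assoc]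
    rw [Matrix.sub_mul, Matrix.one_mul, sub_eq_zero] at h1
    rw [← h1]
  have hP := suppProj_isHermitian σ
  have h3 : suppProj σ * M = suppProj σ := by
    have := congrArg Matrix.conjTranspose h2
    rwa [Matrix.conjTranspose_mul, hP.eq, hM.1.eq] at this
  have h4 := hM.conjTranspose_mul_mul_same (1 - suppProj σ)
  rw [(Matrix.isHermitian_one.sub hP).eq] at h4
  convert h4 using 1
  rw [Matrix.mul_sub, Matrix.mul_one, Matrix.sub_mul, Matrix.one_mul, h3, Matrix.sub_mul, h2,
    suppProj_mul_suppProj, sub_self, sub_zero]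

end SupportProjection

/-! ### The covering cost of a support -/

section Bounds

variable {k : ℕ} {n : Fin k → ℕ} {σ τ : Matrix (Idx n) (Idx n) ℂ}

/-- The least trace of a separable operator dominating the support projection of `σ`. -/
def coverCost (σ : Matrix (Idx n) (Idx n) ℂ) : ℝ :=
  sInf {x : ℝ | ∃ X ∈ sepCone n, (X - suppProj σ).PosSemidef ∧ x = X.trace.re}

theorem coverCost_le {X : Matrix (Idx n) (Idx n) ℂ} (hX : X ∈ sepCone n)
    (h : (X - suppProj σ).PosSemidef) : coverCost σ ≤ X.trace.re := by
  refine csInf_le ⟨0, ?_⟩ ⟨X, hX, h, rfl⟩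
  rintro _ ⟨Y, hY, -, rfl⟩
  exact trace_re_nonneg (posSemidef_of_mem_sepCone hY)

theorem le_coverCost {b : ℝ} (h : ∀ X ∈ sepCone n, (X - suppProj σ).PosSemidef → b ≤ X.trace.re) :
    b ≤ coverCost σ := by
  refine le_csInf ⟨_, 1, one_mem_sepCone, one_sub_suppProj_posSemidef σ, rfl⟩ ?_
  rintro _ ⟨X, hX, hX1, rfl⟩
  exact h X hX hX1

/-! ### Robustness -/

/-- A separable operator dominating `τ` gives an admissible value for the global robustness. -/
theorem trace_sub_one_mem_robustness {X : Matrix (Idx n) (Idx n) ℂ} (hτ : IsState τ)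
    (hX : X ∈ sepCone n) (h : (X - τ).PosSemidef) :
    X.trace.re - 1 ∈ {t : ℝ | 0 ≤ t ∧ ∃ ρ : Matrix (Idx n) (Idx n) ℂ, IsState ρ ∧
      IsSepState ((1 + t)⁻¹ • (τ + t • ρ))} := by
  obtain ⟨t, ht⟩ : ∃ t, t = X.trace.re - 1 := ⟨_, rfl⟩
  have htr : (X - τ).trace.re = t := by
    rw [Matrix.trace_sub, hτ.2, Complex.sub_re, Complex.one_re, ht]
  have ht0 : 0 ≤ t := htr ▸ trace_re_nonneg h
  rw [← ht]
  refine ⟨ht0, ?_⟩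
  -- for `t = 0` the operator is `τ` itself and any state `ρ` will do
  rcases ht0.eq_or_lt with h0 | h0
  · have h1 := eq_zero_of_trace_re_eq_zero h (htr.trans h0.symm)
    rw [sub_eq_zero] at h1
    refine ⟨τ, hτ, ?_⟩
    rw [← h0, zero_smul, add_zero, add_zero, inv_one, one_smul]
    exact ⟨hτ, h1 ▸ hX⟩
  · refine ⟨t⁻¹ • (X - τ), ⟨h.smul (inv_nonneg.2 ht0), ?_⟩, ?_⟩
    · rw [Matrix.trace_smul, trace_eq_ofReal_re h, htr, Complex.real_smul, ← Complex.ofReal_mul,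
        inv_mul_cancel₀ h0.ne', Complex.ofReal_one]
    · rw [smul_smul, mul_inv_cancel₀ h0.ne', one_smul, add_sub_cancel]
      have h1 : 0 < 1 + t := by linarith
      have hXp := posSemidef_of_mem_sepCone hX
      refine ⟨⟨hXp.smul (inv_nonneg.2 h1.le), ?_⟩, smul_mem_sepCone hX (inv_nonneg.2 h1.le)⟩
      rw [Matrix.trace_smul, trace_eq_ofReal_re hXp, show X.trace.re = 1 + t by linarith,
        Complex.real_smul, ← Complex.ofReal_mul, inv_mul_cancel₀ h1.ne', Complex.ofReal_one]

theorem one_add_globalRobustness_le {X : Matrix (Idx n) (Idx n) ℂ} (hτ : IsState τ)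
    (hX : X ∈ sepCone n) (h : (X - τ).PosSemidef) : 1 + globalRobustness τ ≤ X.trace.re := by
  have := csInf_le ⟨0, fun t ht => ht.1⟩ (trace_sub_one_mem_robustness hτ hX h)
  change globalRobustness τ ≤ _ at this
  linarith

theorem robustness_value_le_coverCost (hσ : IsState σ) (hτ : τ ∈ fullRankStates (support σ)) :
    (maxEigenvalue τ)⁻¹ * (1 + globalRobustness τ) ≤ coverCost σ := by
  obtain ⟨hs, hle, -⟩ := hτ
  have hα := maxEigenvalue_pos hs
  refine le_coverCost fun X hX h => ?_
  have h1 : (maxEigenvalue τ • X - τ).PosSemidef := by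
    have := (h.smul hα.le).add (maxEigenvalue_smul_suppProj_sub_posSemidef hσ.1.1 hs.1.1 hle)
    rwa [smul_sub, sub_add_sub_cancel] at this
  have h2 := one_add_globalRobustness_le hs (smul_mem_sepCone hX hα.le) h1
  rw [Matrix.trace_smul, Complex.smul_re, smul_eq_mul] at h2
  rwa [inv_mul_le_iff₀ hα]

/-- A separable decomposition of the maximally mixed state with weight `t` rescales to a separable
operator dominating the support projection. -/
theorem coverCost_le_mixedState (hσ : IsState σ) :
    coverCost σ ≤ (suppProj σ).trace.re * (1 + globalRobustness (mixedState σ)) := by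
  have hr := trace_suppProj_pos hσ
  have hst := mixedState_isState hσ
  suffices h : (suppProj σ).trace.re⁻¹ * coverCost σ - 1 ≤ globalRobustness (mixedState σ) by
    rw [← inv_mul_le_iff₀ hr]
    linarith
  have hone : ((1 : Matrix (Idx n) (Idx n) ℂ) - mixedState σ).PosSemidef := by
    have := trace_smul_one_sub_posSemidef hst.1
    rwa [hst.2, Complex.one_re, one_smul] at this
  refine le_csInf ⟨_, trace_sub_one_mem_robustness hst one_mem_sepCone hone⟩ ?_
  rintro t ⟨ht, ρ, hρ, hω, hsep⟩
  have h1 : 0 < 1 + t := by linarith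
  have h2 := coverCost_le (σ := σ) (smul_mem_sepCone hsep (mul_pos hr h1).le) (by
    rw [smul_smul, mul_assoc, mul_inv_cancel₀ h1.ne', mul_one, smul_add, mixedState, smul_smul,
      mul_inv_cancel₀ hr.ne', one_smul, add_sub_cancel_left, smul_smul]
    exact hρ.1.smul (mul_nonneg hr.le ht))
  rw [Matrix.trace_smul, hω.2, Complex.smul_re, Complex.one_re, smul_eq_mul, mul_one] at h2
  rw [← inv_mul_le_iff₀ hr] at h2
  linarith

/-- The maximum over the full-rank states on the support of `σ` is attained at the maximally mixed
state, and equals the least trace of a separable operator dominating the support projection. -/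
theorem isGreatest_robustnessValues (hσ : IsState σ) :
    IsGreatest (robustnessValues σ) (coverCost σ) := by
  refine ⟨⟨mixedState σ, mixedState_mem hσ, ?_⟩, ?_⟩
  · refine le_antisymm (robustness_value_le_coverCost hσ (mixedState_mem hσ)) ?_
    have hα := maxEigenvalue_pos (mixedState_isState hσ)
    have hr := trace_suppProj_pos hσ
    have hR : 0 ≤ globalRobustness (mixedState σ) := Real.sInf_nonneg fun t ht => ht.1
    refine (coverCost_le_mixedState hσ).trans (mul_le_mul_of_nonneg_right ?_ (by linarith))
    exact (le_inv_comm₀ hα hr).1 (maxEigenvalue_mixedState_le hσ)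
  · rintro _ ⟨τ, hτ, rfl⟩
    exact robustness_value_le_coverCost hσ hτ

theorem optRobustness_eq_coverCost (hσ : IsState σ) : optRobustness σ = coverCost σ :=
  (isGreatest_robustnessValues hσ).csSup_eq

/-! ### Separable test operators -/

theorem coverCost_le_sepDist (hσ : IsState σ) : coverCost σ ≤ sepDist σ := by
  have h1 : (σ * 1).trace.re = 1 := by rw [Matrix.mul_one, hσ.2, Complex.one_re]
  refine le_csInf ⟨_, 1, one_mem_sepCone, by rw [h1]; exact one_pos, ?_, ?_, rfl⟩ ?_
  · rw [h1, inv_one, one_smul]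
    exact Matrix.PosSemidef.one
  · rw [h1, inv_one, one_smul, sub_self]
    exact Matrix.PosSemidef.zero
  · rintro _ ⟨M, hM, hpos, hM0, hM1, rfl⟩
    have h2 := coverCost_le (smul_mem_sepCone hM (inv_nonneg.2 hpos.le))
      (sub_suppProj_posSemidef hσ hM0 hM1 (by
        rw [Matrix.mul_smul, Matrix.trace_smul, Complex.smul_re, smul_eq_mul,
          inv_mul_cancel₀ hpos.ne']))
    rwa [Matrix.trace_smul, Complex.smul_re, smul_eq_mul, inv_mul_eq_div] at h2

theorem sepDist_le {M : Matrix (Idx n) (Idx n) ℂ} (hM : M ∈ sepCone n)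
    (hM1 : (1 - M).PosSemidef) (htr : (σ * M).trace = 1) : sepDist σ ≤ M.trace.re := by
  have h1 : (σ * M).trace.re = 1 := by rw [htr, Complex.one_re]
  refine csInf_le ⟨0, ?_⟩ ⟨M, hM, by rw [h1]; exact one_pos, ?_, ?_, by rw [h1, div_one]⟩
  · rintro _ ⟨Y, hY, hpos, -, -, rfl⟩
    exact div_nonneg (trace_re_nonneg (posSemidef_of_mem_sepCone hY)) hpos.le
  · rw [h1, inv_one, one_smul]
    exact posSemidef_of_mem_sepCone hM
  · rwa [h1, inv_one, one_smul]

/-! ### Entropies -/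

theorem relEntropy_eq_coe_iff {ω : Matrix (Idx n) (Idx n) ℂ} {x : ℝ} :
    relEntropy τ ω = (x : EReal) ↔
      support τ ≤ support ω ∧ x = -entropy τ - (τ * log2 ω).trace.re := by
  rw [relEntropy, entropy]
  split_ifs with h
  · rw [EReal.coe_eq_coe_iff, Matrix.mul_sub, Matrix.trace_sub, Complex.sub_re, neg_neg]
    exact ⟨fun hx => ⟨h, hx.symm⟩, fun hx => hx.2.symm⟩
  · exact ⟨fun hx => absurd hx (EReal.top_ne_coe x), fun hx => absurd hx.1 h⟩

/-- The relative entropies to separable states are bounded below, so their infimum is genuine. -/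
theorem neg_entropy_le_of_relEntropy_eq {ω : Matrix (Idx n) (Idx n) ℂ} (hτ : IsState τ)
    (hω : IsState ω) {x : ℝ} (hx : relEntropy τ ω = (x : EReal)) : -entropy τ ≤ x := by
  obtain ⟨hle, rfl⟩ := relEntropy_eq_coe_iff.1 hx
  have h1 := trace_mul_log2_le hτ hω.1 hle
  have h2 := Real.logb_nonpos one_lt_two (trace_mul_re_nonneg hτ.1 hω.1) (trace_mul_le_one hτ hω)
  linarith

/-- Normalizing a separable operator `X` that dominates the support projection gives a separable
state whose relative entropy to `τ` is at most `log₂ Tr X - S(τ)`. -/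
theorem exists_relEntropy_le {X : Matrix (Idx n) (Idx n) ℂ} (hσ : IsState σ) (hτ : IsState τ)
    (hle : support τ ≤ support σ) (hX : X ∈ sepCone n) (h : (X - suppProj σ).PosSemidef) :
    ∃ (ω : Matrix (Idx n) (Idx n) ℂ) (x : ℝ), IsSepState ω ∧ relEntropy τ ω = (x : EReal) ∧
      x ≤ Real.logb 2 X.trace.re - entropy τ := by
  have hr := trace_suppProj_pos hσ
  have hc : 0 < X.trace.re := by
    have := trace_re_nonneg h
    rw [Matrix.trace_sub, Complex.sub_re] at this
    linarith
  have hXp := posSemidef_of_mem_sepCone hX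
  have hci := inv_pos.2 hc
  obtain ⟨ω, hω⟩ : ∃ ω, ω = X.trace.re⁻¹ • X := ⟨_, rfl⟩
  have hωs : IsSepState ω := by
    rw [hω]
    refine ⟨⟨hXp.smul hci.le, ?_⟩, smul_mem_sepCone hX hci.le⟩
    rw [Matrix.trace_smul]
    conv_lhs => enter [2]; rw [trace_eq_ofReal_re hXp]
    rw [Complex.real_smul, ← Complex.ofReal_mul, inv_mul_cancel₀ hc.ne', Complex.ofReal_one]
  have hωP : (ω - X.trace.re⁻¹ • suppProj σ).PosSemidef := by
    rw [hω, ← smul_sub]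
    exact h.smul hci.le
  have hP := suppProj_isHermitian σ
  have hPτ := suppProj_mul_of_support_le hσ.1.1 hle
  have hτP := mul_suppProj_of_support_le hσ.1.1 hτ.1.1 hle
  have hωp := hωs.1.1
  have h1 := mul_suppProj_of_le hP (suppProj_mul_suppProj σ) hωp hci hωP
  have h2 : suppProj ω * τ = τ := by
    have := congrArg Matrix.conjTranspose h1
    rw [Matrix.conjTranspose_mul, hP.eq, (suppProj_isHermitian ω).eq] at this
    rw [← hPτ, ← Matrix.mul_assoc, this]
  have h3 : support τ ≤ support ω := by
    rw [← h2, ← support_suppProj hωp.1]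
    exact support_mul_le _ _
  refine ⟨ω, _, hωs, relEntropy_eq_coe_iff.2 ⟨h3, rfl⟩, ?_⟩
  have h4 := logb_le_trace_mul_log2 hP (suppProj_mul_suppProj σ) hωp hci hωP hτ hPτ hτP
  rw [Real.logb_inv] at h4
  linarith

theorem relEntropyEnt_add_entropy_le {X : Matrix (Idx n) (Idx n) ℂ} (hσ : IsState σ)
    (hτ : IsState τ) (hle : support τ ≤ support σ) (hX : X ∈ sepCone n)
    (h : (X - suppProj σ).PosSemidef) :
    relEntropyEnt τ + entropy τ ≤ Real.logb 2 X.trace.re := by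
  obtain ⟨ω, x, hω, hx, hxle⟩ := exists_relEntropy_le hσ hτ hle hX h
  have h1 : relEntropyEnt τ ≤ x := by
    refine csInf_le ⟨-entropy τ, ?_⟩ ⟨ω, hω, hx⟩
    rintro y ⟨ω', hω', hy⟩
    exact neg_entropy_le_of_relEntropy_eq hτ hω'.1 hy
  linarith

theorem two_rpow_le_coverCost (hσ : IsState σ) {x : ℝ} (hx : x ∈ entropyValues σ) :
    (2 : ℝ) ^ x ≤ coverCost σ := by
  obtain ⟨τ, ⟨hτ, hle, -⟩, rfl⟩ := hx
  refine le_coverCost fun X hX h => ?_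
  have hc : 0 < X.trace.re := by
    have := trace_re_nonneg h
    rw [Matrix.trace_sub, Complex.sub_re] at this
    linarith [trace_suppProj_pos hσ]
  rw [← Real.le_logb_iff_rpow_le one_lt_two hc]
  exact relEntropyEnt_add_entropy_le hσ hτ hle hX h

theorem coverCost_pos (hσ : IsState σ) : 0 < coverCost σ :=
  (Real.rpow_pos_of_pos two_pos _).trans_le
    (two_rpow_le_coverCost hσ ⟨_, mixedState_mem hσ, rfl⟩)

theorem isLUB_entropyValues (hσ : IsState σ) : IsLUB (entropyValues σ) (optEntropy σ) := by
  refine isLUB_csSup ⟨_, _, mixedState_mem hσ, rfl⟩ ⟨Real.logb 2 (coverCost σ), fun x hx => ?_⟩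
  rw [Real.le_logb_iff_rpow_le one_lt_two (coverCost_pos hσ)]
  exact two_rpow_le_coverCost hσ hx

theorem two_rpow_optEntropy_le (hσ : IsState σ) : (2 : ℝ) ^ optEntropy σ ≤ coverCost σ := by
  rw [← Real.le_logb_iff_rpow_le one_lt_two (coverCost_pos hσ)]
  refine (isLUB_entropyValues hσ).2 fun x hx => ?_
  rw [Real.le_logb_iff_rpow_le one_lt_two (coverCost_pos hσ)]
  exact two_rpow_le_coverCost hσ hx

/-! ### The geometric measure -/

theorem trace_mul_vecMulVec_star (w : Idx n → ℂ) :
    (τ * Matrix.vecMulVec w (star w)).trace = star w ⬝ᵥ (τ *ᵥ w) := by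
  rw [Matrix.mul_vecMulVec, Matrix.trace_vecMulVec, dotProduct_comm]

theorem product_overlap_le_sSup (hτ : IsState τ) {v : ∀ p, Fin (n p) → ℂ}
    (hv : ∀ p, star (v p) ⬝ᵥ v p = 1) :
    (star (tensorVec v) ⬝ᵥ (τ *ᵥ tensorVec v)).re ≤
      sSup {x : ℝ | ∃ v : ∀ p, Fin (n p) → ℂ, (∀ p, star (v p) ⬝ᵥ v p = 1) ∧
        x = (star (tensorVec v) ⬝ᵥ (τ *ᵥ tensorVec v)).re} := by
  refine le_csSup ⟨1, ?_⟩ ⟨v, hv, rfl⟩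
  rintro _ ⟨u, hu, rfl⟩
  rw [← trace_mul_vecMulVec_star]
  exact trace_mul_le_one hτ ⟨Matrix.posSemidef_vecMulVec_self_star _,
    trace_of_mem_productProjections ⟨u, hu, rfl⟩⟩

/-- If the overlaps of `τ` with product vectors are at most `m`, so are those with separable
states. -/
theorem trace_mul_sepState_le (hn : ∀ p, 0 < n p)
    {ω : Matrix (Idx n) (Idx n) ℂ} (hω : IsSepState ω) {m : ℝ}
    (hm : ∀ v : ∀ p, Fin (n p) → ℂ, (∀ p, star (v p) ⬝ᵥ v p = 1) →
      (star (tensorVec v) ⬝ᵥ (τ *ᵥ tensorVec v)).re ≤ m) : (τ * ω).trace.re ≤ m := by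
  obtain ⟨Y, hY, h⟩ := exists_eq_trace_smul hn hω.2
  rw [hω.1.2, Complex.one_re, one_smul] at h
  subst h
  refine convexHull_min (t := {X | (τ * X).trace.re ≤ m}) ?_ ?_ hY
  · rintro _ ⟨v, hv, rfl⟩
    change (τ * Matrix.vecMulVec _ _).trace.re ≤ m
    rw [trace_mul_vecMulVec_star]
    exact hm v hv
  · intro X hX Z hZ a b ha hb hab
    change (τ * X).trace.re ≤ _ at hX
    change (τ * Z).trace.re ≤ _ at hZ
    change (τ * (a • X + b • Z)).trace.re ≤ _
    rw [Matrix.mul_add, Matrix.mul_smul, Matrix.mul_smul, Matrix.trace_add, Matrix.trace_smul,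
      Matrix.trace_smul, Complex.add_re, Complex.smul_re, Complex.smul_re]
    exact (add_le_add (mul_le_mul_of_nonneg_left hX ha) (mul_le_mul_of_nonneg_left hZ hb)).trans
      (le_of_eq (by rw [← add_mul, hab, one_mul]))

theorem geomMeasure_le (hn : ∀ p, 0 < n p) (hτ : IsState τ) :
    geomMeasure τ ≤ relEntropyEnt τ + entropy τ := by
  suffices h : geomMeasure τ - entropy τ ≤ relEntropyEnt τ by linarith
  obtain ⟨ω, x, hω, hx, -⟩ := exists_relEntropy_le hτ hτ le_rfl one_mem_sepCone
    (one_sub_suppProj_posSemidef τ)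
  refine le_csInf ⟨x, ω, hω, hx⟩ ?_
  rintro y ⟨ω', hω', hy⟩
  obtain ⟨hle, rfl⟩ := relEntropy_eq_coe_iff.1 hy
  have h1 := trace_mul_log2_le hτ hω'.1.1 hle
  have h2 := Real.logb_le_logb_of_le one_lt_two (trace_mul_pos_of_support_le hτ hω'.1.1 hle)
    (trace_mul_sepState_le hn hω' fun v hv => product_overlap_le_sSup hτ hv)
  rw [geomMeasure]
  linarith

theorem geom_value_le_optEntropy (hn : ∀ p, 0 < n p) (hσ : IsState σ) {x : ℝ}
    (hx : x ∈ geomValues σ) : x ≤ optEntropy σ := by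
  obtain ⟨τ, hτ, rfl⟩ := hx
  exact (geomMeasure_le hn hτ.1).trans ((isLUB_entropyValues hσ).1 ⟨τ, hτ, rfl⟩)

theorem isLUB_geomValues (hn : ∀ p, 0 < n p) (hσ : IsState σ) :
    IsLUB (geomValues σ) (optGeom σ) :=
  isLUB_csSup ⟨_, _, mixedState_mem hσ, rfl⟩ ⟨_, fun _ hx => geom_value_le_optEntropy hn hσ hx⟩

theorem optGeom_le_optEntropy (hn : ∀ p, 0 < n p) (hσ : IsState σ) :
    optGeom σ ≤ optEntropy σ :=
  (isLUB_geomValues hn hσ).2 fun _ hx => geom_value_le_optEntropy hn hσ hx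

end Bounds

/-! ### Averages and the counting bound -/

section Average

variable {N : ℕ}

theorem avg_mono {x y : Fin N → ℝ} (h : ∀ i, x i ≤ y i) : avg x ≤ avg y :=
  mul_le_mul_of_nonneg_left (Finset.sum_le_sum fun i _ => h i) (by positivity)

theorem avg_pos (hN : 0 < N) {x : Fin N → ℝ} (h : ∀ i, 0 < x i) : 0 < avg x := by
  have : Nonempty (Fin N) := ⟨⟨0, hN⟩⟩
  exact mul_pos (by positivity) (Finset.sum_pos (fun i _ => h i) Finset.univ_nonempty)

theorem natCast_mul_avg (hN : 0 < N) (x : Fin N → ℝ) : N * avg x = ∑ i, x i := by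
  have : (N : ℝ) ≠ 0 := by positivity
  rw [avg, ← mul_assoc, mul_one_div_cancel this, one_mul]

end Average

theorem IsLOCC.one_sub_posSemidef {k N : ℕ} {n : Fin k → ℕ} (hn : ∀ p, 0 < n p)
    {M : Fin N → Matrix (Idx n) (Idx n) ℂ} (hM : IsLOCC M) (i : Fin N) :
    (1 - M i).PosSemidef := by
  rw [← hM.sum_eq_one, ← Finset.add_sum_erase _ _ (Finset.mem_univ i), add_sub_cancel_left]
  exact Matrix.posSemidef_sum _ fun j _ => posSemidef_of_mem_sepCone (hM.mem_sepCone hn j)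

/-- The counting bound: the elements of the measurement share the total trace `∏ p, n p`, and the
one detecting `σ i` takes at least `sepDist (σ i)` of it. -/
theorem sum_sepDist_le {k N : ℕ} {n : Fin k → ℕ} (hn : ∀ p, 0 < n p)
    {σ : Fin N → Matrix (Idx n) (Idx n) ℂ} (h : PerfectlyLOCCDistinguishable σ) :
    ∑ i, sepDist (σ i) ≤ ((∏ p, n p : ℕ) : ℝ) := by
  obtain ⟨M, hM, hMσ⟩ := h
  calc ∑ i, sepDist (σ i) ≤ ∑ i, (M i).trace.re := Finset.sum_le_sum fun i _ =>
        sepDist_le (hM.mem_sepCone hn i) (hM.one_sub_posSemidef hn i)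
          (by rw [Matrix.trace_mul_comm, hMσ, if_pos rfl])
    _ = (∑ i, M i).trace.re := by rw [Matrix.trace_sum, Complex.re_sum]
    _ = ((∏ p, n p : ℕ) : ℝ) := by
        rw [hM.sum_eq_one, Matrix.trace_one, Fintype.card_pi, Complex.natCast_re]
        simp

end LOCCBound

end

theorem theorem3 {k : ℕ} (n : Fin k → ℕ) (D : ℕ) (hD : D = ∏ p, n p)
    (N : ℕ) (hN : 0 < N)
    (σ : Fin N → Matrix (LOCCBound.Idx n) (LOCCBound.Idx n) ℂ)
    (hσ : ∀ i, LOCCBound.IsState (σ i))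
    (hLOCC : LOCCBound.PerfectlyLOCCDistinguishable σ) :
    (∀ i, IsGreatest (LOCCBound.robustnessValues (σ i)) (LOCCBound.optRobustness (σ i)) ∧
      IsLUB (LOCCBound.entropyValues (σ i)) (LOCCBound.optEntropy (σ i)) ∧
      IsLUB (LOCCBound.geomValues (σ i)) (LOCCBound.optGeom (σ i))) ∧
    (N : ℝ) ≤ D / LOCCBound.avg (fun i => LOCCBound.sepDist (σ i)) ∧
    D / LOCCBound.avg (fun i => LOCCBound.sepDist (σ i)) ≤
      D / LOCCBound.avg (fun i => LOCCBound.optRobustness (σ i)) ∧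
    D / LOCCBound.avg (fun i => LOCCBound.optRobustness (σ i)) ≤
      D / LOCCBound.avg (fun i => (2 : ℝ) ^ LOCCBound.optEntropy (σ i)) ∧
    D / LOCCBound.avg (fun i => (2 : ℝ) ^ LOCCBound.optEntropy (σ i)) ≤
      D / LOCCBound.avg (fun i => (2 : ℝ) ^ LOCCBound.optGeom (σ i)) := by
  open LOCCBound in
  -- the trace-one operator `σ 0` exists, so no local space is trivial
  have hn : ∀ p, 0 < n p := fun p => by
    obtain ⟨x⟩ := (hσ ⟨0, hN⟩).nonempty
    exact (x p).pos
  have hD0 : (0 : ℝ) ≤ D := Nat.cast_nonneg D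
  have hR i := optRobustness_eq_coverCost (hσ i)
  refine ⟨fun i => ⟨?_, isLUB_entropyValues (hσ i), isLUB_geomValues hn (hσ i)⟩, ?_, ?_, ?_, ?_⟩
  · rw [hR]
    exact isGreatest_robustnessValues (hσ i)
  · rw [le_div_iff₀ (avg_pos hN fun i => (coverCost_pos (hσ i)).trans_le
      (coverCost_le_sepDist (hσ i))), natCast_mul_avg hN, hD]
    exact sum_sepDist_le hn hLOCC
  · simp only [hR]
    exact div_le_div_of_nonneg_left hD0 (avg_pos hN fun i => coverCost_pos (hσ i))
      (avg_mono fun i => coverCost_le_sepDist (hσ i))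
  · simp only [hR]
    exact div_le_div_of_nonneg_left hD0 (avg_pos hN fun i => Real.rpow_pos_of_pos two_pos _)
      (avg_mono fun i => two_rpow_optEntropy_le (hσ i))
  · exact div_le_div_of_nonneg_left hD0 (avg_pos hN fun i => Real.rpow_pos_of_pos two_pos _)
      (avg_mono fun i => Real.rpow_le_rpow_of_exponent_le one_le_two
        (optGeom_le_optEntropy hn (hσ i)))
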